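/- Let $q$ be a prime power and let $V$ be a 4-dimensional vector space over $\mathbb{F}_{q^2}$ with a nondegenerate Hermitian form $h$ (with respect to $x\mapsto x^q$). Let $\mathsf{H}(3,q^2)$ be the Hermitian surface whose points and lines are the isotropic points and the totally isotropic lines of $h$ in $\mathrm{PG}(V)=\mathrm{PG}(3,q^2)$. Let $\sigma$ be a semilinear map of $V$ with companion automorphism $x\mapsto x^q$ and $\sigma^2=1$ (a Baer involution), such that the restriction of $h$ to the $\mathbb{F}_q$-space of vectors fixed by $\sigma$ is alternating. Let $\mathsf{W}(3,q)$ be the symplectic subgeometry of $\mathsf{H}(3,q^2)$ whose points and lines are the points and lines of $\mathsf{H}(3,q^2)$ fixed by $\sigma$. Two lines $\ell,\ell'$ of $\mathsf{H}(3,q^2)$ not in $\mathsf{W}(3,q)$ are conjugate if $\ell'=\ell^\sigma$. For an integer $m\ge 0$, an $m$-cover of $\mathsf{H}(3,q^2)\setminus\mathsf{W}(3,q)$ is a set $Y$ of lines of $\mathsf{H}(3,q^2)$ not in $\mathsf{W}(3,q)$ such that every point of $\mathsf{H}(3,q^2)$ not in $\mathsf{W}(3,q)$ lies on exactly $m$ lines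 of $Y$. It is nontrivial if it is neither empty nor the set of all lines of $\mathsf{H}(3,q^2)$ not in $\mathsf{W}(3,q)$. Theorem. If $Y$ is a nontrivial $m$-cover of $\mathsf{H}(3,q^2)\setminus\mathsf{W}(3,q)$, then $q$ is even and $m=q/2$. Moreover, for every line $\ell$ of $\mathsf{H}(3,q^2)$ not in $\mathsf{W}(3,q)$, exactly one of the conjugate lines $\ell$ and $\ell^\sigma$ lies in $Y$. -/

import Mathlib

namespace HermitianSurface

/-- For finite fields `F ⊆ K` with `|F| = q`, the field automorphism `x ↦ x ^ q` of `K`.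
It is the involutory automorphism of `K` over `F` when `[K : F] = 2`. -/
noncomputable def conj (F K : Type*) [Field F] [Fintype F] [Field K] [Algebra F K] : K →+* K :=
  (FiniteField.frobeniusAlgHom F K).toRingHom

theorem conj_apply (F K : Type*) [Field F] [Fintype F] [Field K] [Algebra F K] (x : K) :
    conj F K x = x ^ Fintype.card F := rfl

instance conj_surjective (F K : Type*) [Field F] [Fintype F] [Field K] [Finite K] [Algebra F K] :
    RingHomSurjective (conj F K) :=
  ⟨Finite.injective_iff_surjective.mp (conj F K).injective⟩

variable {F K V : Type*} [Field F] [Fintype F] [Field K] [Finite K] [Algebra F K]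
  [AddCommGroup V] [Module K V]

/-- A nondegenerate Hermitian form with respect to `x ↦ x ^ q`
(conjugate-linear in the first variable). -/
structure IsHermitianForm (h : V →ₛₗ[conj F K] V →ₗ[K] K) : Prop where
  conj_symm : ∀ u v, h u v = conj F K (h v u)
  nondegenerate : ∀ u, (∀ v, h u v = 0) → u = 0

/-- Vector form of an involution of the projective space of `V` whose fixed subspaces form a
Baer subgeometry over `F`: a semilinear map with companion automorphism `x ↦ x ^ q`
and square the identity. -/
def IsBaerInvolution (σ : V →ₛₗ[conj F K] V) : Prop :=
  ∀ v, σ (σ v) = v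

/-- The Baer subgeometry of `σ` is symplectic with respect to `h`: on the `F`-space of vectors
fixed by `σ`, the restriction of `h` is alternating. For a Hermitian form `h` this restriction is
then a scalar multiple of an `F`-valued alternating form. -/
def IsSymplecticSubgeometry (h : V →ₛₗ[conj F K] V →ₗ[K] K) (σ : V →ₛₗ[conj F K] V) : Prop :=
  ∀ v, σ v = v → h v v = 0

/-- The points of the Hermitian surface: the isotropic points of `h`. -/
def hermitianPoints (h : V →ₛₗ[conj F K] V →ₗ[K] K) : Set (Projectivization K V) :=
  {P | ∀ v ∈ P.submodule, h v v = 0}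

/-- The lines of the Hermitian surface: the two-dimensional totally isotropic subspaces of `h`. -/
def hermitianLines (h : V →ₛₗ[conj F K] V →ₗ[K] K) : Set (Submodule K V) :=
  {l | Module.finrank K l = 2 ∧ ∀ u ∈ l, ∀ v ∈ l, h u v = 0}

/-- The image of a subspace under `σ`; the conjugate of `l`. -/
noncomputable def conjugate (σ : V →ₛₗ[conj F K] V) (l : Submodule K V) : Submodule K V :=
  l.map σ

/-- The points of the symplectic subgeometry: the points of the Hermitian surface that are
fixed by `σ`. -/
def symplecticPoints (h : V →ₛₗ[conj F K] V →ₗ[K] K) (σ : V →ₛₗ[conj F K] V) :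
    Set (Projectivization K V) :=
  {P ∈ hermitianPoints h | conjugate σ P.submodule = P.submodule}

/-- The (extended) lines of the symplectic subgeometry: the totally isotropic lines that are
fixed by `σ`. -/
def symplecticLines (h : V →ₛₗ[conj F K] V →ₗ[K] K) (σ : V →ₛₗ[conj F K] V) :
    Set (Submodule K V) :=
  {l ∈ hermitianLines h | conjugate σ l = l}

/-- An `m`-cover of the Hermitian surface minus the symplectic subgeometry: a set of lines of the
surface outside the subgeometry such that every point of the surface outside the
subgeometry is on exactly `m` of them. -/
structure IsCover (h : V →ₛₗ[conj F K] V →ₗ[K] K) (σ : V →ₛₗ[conj F K] V) (m : ℕ)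
    (Y : Set (Submodule K V)) : Prop where
  subset : Y ⊆ hermitianLines h \ symplecticLines h σ
  ncard_eq : ∀ P ∈ hermitianPoints h \ symplecticPoints h σ,
    {l | l ∈ Y ∧ P.submodule ≤ l}.ncard = m

/-- An `m`-cover is nontrivial if it is neither empty nor the set of all lines of the surface
outside the subgeometry. -/
structure IsNontrivialCover (h : V →ₛₗ[conj F K] V →ₗ[K] K) (σ : V →ₛₗ[conj F K] V) (m : ℕ)
    (Y : Set (Submodule K V)) : Prop extends IsCover h σ m Y where
  nonempty : Y.Nonempty
  ne_all : Y ≠ hermitianLines h \ symplecticLines h σ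

end HermitianSurface

namespace HermitianSurface

/-- If a homomorphism out of a group of order `a * b` has at most `a` elements in its kernel and
takes values in a set of at most `b` elements, then all fibres over that set have `a` elements. -/
@[to_additive card_fiber_of_card_addKer_le /-- If a homomorphism out of a group of order `a * b` has at most `a` elements in its
kernel and takes values in a set of at most `b` elements, then all fibres over that set have `a`
elements. -/]
theorem card_fiber_of_card_ker_le {G H : Type*} [Group G] [Finite G] [Group H] [Finite H]
    (f : G →* H) (S : Set H) (hS : ∀ x, f x ∈ S) {a b : ℕ} (hG : Nat.card G = a * b)
    (ha : Nat.card f.ker ≤ a) (hb : S.ncard ≤ b) (d : H) (hd : d ∈ S) :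
    {x | f x = d}.ncard = a := by
  have hpos : 0 < a * b := hG ▸ Nat.card_pos
  have h1 : Nat.card f.ker * Nat.card f.range = a * b := by
    rw [← Subgroup.index_ker, Subgroup.card_mul_index, hG]
  have hsub : (f.range : Set H) ⊆ S := by
    rintro _ ⟨x, rfl⟩; exact hS x
  have hrS : Nat.card f.range ≤ S.ncard := Set.ncard_le_ncard hsub (Set.toFinite _)
  have ha0 : 0 < a := Nat.pos_of_mul_pos_right hpos
  have hb0 : 0 < b := Nat.pos_of_mul_pos_left hpos
  have hker : Nat.card f.ker = a := by
    by_contra hne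
    have : Nat.card f.ker < a := lt_of_le_of_ne ha hne
    nlinarith [Nat.card_pos (α := f.range)]
  have hran : Nat.card f.range = b := by
    rw [hker] at h1; exact Nat.eq_of_mul_eq_mul_left ha0 h1
  have heq : (f.range : Set H) = S :=
    Set.eq_of_subset_of_ncard_le hsub (hb.trans hran.ge) (Set.toFinite _)
  obtain ⟨y, rfl⟩ : d ∈ (f.range : Set H) := heq ▸ hd
  rw [← hker]
  refine (Set.ncard_congr (fun x _ => y * x) ?_ ?_ ?_).symm
  · intro x (hx : x ∈ f.ker)
    simp [MonoidHom.mem_ker.mp hx]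
  · intro x z _ _ hxz
    exact mul_left_cancel hxz
  · intro x hx
    refine ⟨y⁻¹ * x, ?_, by simp⟩
    have hx' : f x = f y := hx
    change y⁻¹ * x ∈ f.ker
    simp [MonoidHom.mem_ker, hx']

theorem ncard_pow_card_eq_mul_le {F K : Type*} [Field F] [Fintype F] [Field K] [Finite K] (c : K) :
    {x : K | x ^ Fintype.card F = c * x}.ncard ≤ Fintype.card F := by
  classical
  have hq : 1 < Fintype.card F := Fintype.one_lt_card
  set p : Polynomial K := Polynomial.X ^ Fintype.card F - Polynomial.C c * Polynomial.X with hp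
  have hlt : (Polynomial.C c * Polynomial.X : Polynomial K).natDegree <
      (Polynomial.X ^ Fintype.card F : Polynomial K).natDegree := by
    rw [Polynomial.natDegree_X_pow]
    exact (by compute_degree : _ ≤ 1).trans_lt hq
  have hdeg : p.natDegree = Fintype.card F := by
    rw [hp, Polynomial.natDegree_sub_eq_left_of_natDegree_lt hlt, Polynomial.natDegree_X_pow]
  have hp0 : p ≠ 0 := by
    intro h0; rw [h0, Polynomial.natDegree_zero] at hdeg; omega
  have hsub : {x : K | x ^ Fintype.card F = c * x} ⊆ (p.roots.toFinset : Set K) := by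
    intro x (hx : _ = _)
    rw [Finset.mem_coe, Multiset.mem_toFinset, Polynomial.mem_roots hp0]
    simp [hp, hx]
  calc _ ≤ (p.roots.toFinset : Set K).ncard := Set.ncard_le_ncard hsub (Set.toFinite _)
    _ = p.roots.toFinset.card := Set.ncard_coe_finset _
    _ ≤ p.roots.card := Multiset.toFinset_card_le _
    _ ≤ p.natDegree := p.card_roots'
    _ = _ := hdeg

section Field

variable {F K : Type*} [Field F] [Fintype F] [Field K] [Finite K] [Algebra F K]

theorem card_eq_sq (hK : Module.finrank F K = 2) : Nat.card K = Fintype.card F ^ 2 := by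
  have : Module.Finite F K := Module.finite_of_finrank_pos (by omega)
  rw [Module.natCard_eq_pow_finrank (K := F), hK, Nat.card_eq_fintype_card]

theorem conj_conj (hK : Module.finrank F K = 2) (x : K) : conj F K (conj F K x) = x := by
  have := Fintype.ofFinite K
  rw [conj_apply, conj_apply, ← pow_mul, ← sq, ← card_eq_sq hK, Nat.card_eq_fintype_card,
    FiniteField.pow_card]

theorem ncard_conj_eq_self_le : {x : K | conj F K x = x}.ncard ≤ Fintype.card F := by
  simpa [conj_apply] using ncard_pow_card_eq_mul_le (F := F) (1 : K)

theorem ncard_conj_eq_neg_le : {x : K | conj F K x = -x}.ncard ≤ Fintype.card F := by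
  simpa [conj_apply] using ncard_pow_card_eq_mul_le (F := F) (-1 : K)

theorem exists_conj_ne (hK : Module.finrank F K = 2) : ∃ θ : K, conj F K θ ≠ θ := by
  by_contra! hall
  have h1 := ncard_conj_eq_self_le (F := F) (K := K)
  rw [Set.eq_univ_of_forall (s := {x : K | conj F K x = x}) hall, Set.ncard_univ,
    card_eq_sq hK] at h1
  have hq : 1 < Fintype.card F := Fintype.one_lt_card
  nlinarith

theorem ncard_sub_conj_eq (hK : Module.finrank F K = 2) (d : K) (hd : conj F K d = -d) :
    {s : K | s - conj F K s = d}.ncard = Fintype.card F := by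
  refine card_fiber_of_card_addKer_le
    ((AddMonoidHom.id K) - (conj F K).toAddMonoidHom) {x | conj F K x = -x} ?_
    (by rw [card_eq_sq hK, sq]) ?_ ncard_conj_eq_neg_le d hd
  · intro x
    simp [conj_conj hK]
  · refine le_trans (le_of_eq ?_) (ncard_conj_eq_self_le (F := F) (K := K))
    change Set.ncard _ = _
    congr 1
    ext x
    change x - conj F K x = 0 ↔ conj F K x = x
    rw [sub_eq_zero, eq_comm]

theorem ncard_conj_eq_neg (hK : Module.finrank F K = 2) :
    {s : K | conj F K s = -s}.ncard = Fintype.card F := by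
  obtain ⟨θ, hθ⟩ := exists_conj_ne hK
  set δ := θ - conj F K θ with hδ
  have hδ0 : δ ≠ 0 := sub_ne_zero.mpr hθ.symm
  have hδc : conj F K δ = -δ := by simp [hδ, conj_conj hK]
  rw [← ncard_sub_conj_eq hK 0 (by simp)]
  refine Set.ncard_congr (fun s _ => s * δ) ?_ ?_ ?_
  · intro s (hs : _ = _)
    simp [hs, hδc]
  · intro s t _ _ hst
    exact mul_right_cancel₀ hδ0 hst
  · intro t (ht : _ = _)
    rw [sub_eq_zero] at ht
    refine ⟨t / δ, ?_, div_mul_cancel₀ t hδ0⟩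
    simp [← ht, hδc, div_neg]

theorem ncard_mul_conj_eq (hK : Module.finrank F K = 2) (c : K) (hc : conj F K c = c)
    (hc0 : c ≠ 0) : {t : K | t * conj F K t = c}.ncard = Fintype.card F + 1 := by
  classical
  have := Fintype.ofFinite K
  have hq : 1 < Fintype.card F := Fintype.one_lt_card
  obtain ⟨r, hr⟩ : ∃ r, Fintype.card F = r + 1 := ⟨Fintype.card F - 1, by omega⟩
  have hcard : Nat.card Kˣ = (Fintype.card F + 1) * (Fintype.card F - 1) := by
    rw [Nat.card_units, card_eq_sq hK, hr, Nat.add_sub_cancel]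
    exact Nat.sub_eq_of_eq_add (by ring)
  have hpow : ∀ x : Kˣ, (x ^ (Fintype.card F + 1)) ^ (Fintype.card F - 1) = 1 := by
    intro x
    rw [← pow_mul, ← hcard, pow_card_eq_one']
  have key := card_fiber_of_card_ker_le (powMonoidHom (Fintype.card F + 1) : Kˣ →* Kˣ)
    {x | x ^ (Fintype.card F - 1) = 1} hpow hcard ?_ ?_ (Units.mk0 c hc0) ?_
  · rw [← key]
    symm
    refine Set.ncard_congr (fun (x : Kˣ) _ => (x : K)) ?_ ?_ ?_
    · intro x (hx : _ = _)
      have := congrArg Units.val hx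
      simp only [powMonoidHom_apply, Units.val_pow_eq_pow_val, Units.val_mk0] at this
      change _ * _ = _
      rw [conj_apply, ← this, pow_succ']
    · intro x y _ _ hxy
      exact Units.ext hxy
    · intro t (ht : _ = _)
      have ht0 : t ≠ 0 := by rintro rfl; exact hc0 (by simpa using ht.symm)
      refine ⟨Units.mk0 t ht0, ?_, rfl⟩
      ext
      simpa [conj_apply, pow_succ'] using ht
  · have := IsCyclic.card_pow_eq_one_le (α := Kˣ) (n := Fintype.card F + 1) (by omega)
    refine le_trans (le_of_eq ?_) this
    rw [← Set.ncard_coe_finset]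
    change Set.ncard _ = _
    congr 1
    ext x
    simp [MonoidHom.mem_ker]
  · have := IsCyclic.card_pow_eq_one_le (α := Kˣ) (n := Fintype.card F - 1) (by omega)
    refine le_trans (le_of_eq ?_) this
    rw [← Set.ncard_coe_finset]
    congr 1
    ext x
    simp
  · ext
    rw [conj_apply] at hc
    simp only [Units.val_pow_eq_pow_val, Units.val_mk0, Units.val_one]
    rw [hr, pow_succ] at hc
    rw [hr, Nat.add_sub_cancel]
    exact mul_right_cancel₀ hc0 (by rw [hc, one_mul])

end Field
end HermitianSurface

namespace HermitianSurface
section Plane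

variable {K V : Type*} [Field K] [AddCommGroup V] [Module K V]

theorem finrank_span_pair {v w : V} (hli : LinearIndependent K ![v, w]) :
    Module.finrank K (Submodule.span K {v, w}) = 2 := by
  have := finrank_span_eq_card hli
  rwa [Matrix.range_cons_cons_empty, Fintype.card_fin] at this

theorem span_pair_eq {l : Submodule K V} (hl : Module.finrank K l = 2) {v w : V} (hv : v ∈ l)
    (hw : w ∈ l) (hli : LinearIndependent K ![v, w]) : Submodule.span K {v, w} = l := by
  have : Module.Finite K l := Module.finite_of_finrank_pos (by omega)
  refine Submodule.eq_of_le_of_finrank_eq ?_ (by rw [finrank_span_pair hli, hl])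
  rw [Submodule.span_le]
  rintro x (rfl | rfl) <;> assumption

theorem exists_linearIndependent_pair_mem {l : Submodule K V} (hl : Module.finrank K l = 2)
    {v : V} (hv0 : v ≠ 0) : ∃ w ∈ l, LinearIndependent K ![v, w] := by
  by_contra! hall
  have hle : l ≤ K ∙ v := by
    intro w hw
    have := hall w hw
    rw [LinearIndependent.pair_iff' hv0] at this
    push Not at this
    obtain ⟨a, rfl⟩ := this
    exact Submodule.smul_mem _ _ (Submodule.mem_span_singleton_self v)
  have := Submodule.finrank_mono hle
  rw [hl, finrank_span_singleton hv0] at this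
  omega

end Plane

section Forms

set_option linter.unusedSectionVars false

variable {F K V : Type*} [Field F] [Fintype F] [Field K] [Finite K] [Algebra F K]
  [AddCommGroup V] [Module K V]

/-- A sesquilinear form vanishing on the diagonal is zero. -/
theorem sesquilinear_eq_zero (hK : Module.finrank F K = 2) (s : V →ₛₗ[conj F K] V →ₗ[K] K)
    (hs : ∀ v, s v v = 0) (u v : V) : s u v = 0 := by
  have polar : ∀ x y, s x y + s y x = 0 := by
    intro x y
    have := hs (x + y)
    simpa [hs x, hs y, add_comm] using this
  obtain ⟨θ, hθ⟩ := exists_conj_ne hK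
  have h1 := polar u v
  have h2 := polar u (θ • v)
  simp only [map_smul, map_smulₛₗ, LinearMap.smul_apply, smul_eq_mul] at h2
  have h3 : (θ - conj F K θ) * s u v = 0 := by linear_combination h2 - conj F K θ * h1
  exact (mul_eq_zero.mp h3).resolve_left (sub_ne_zero.mpr hθ.symm)

variable {h : V →ₛₗ[conj F K] V →ₗ[K] K} {σ : V →ₛₗ[conj F K] V}

theorem IsSymplecticSubgeometry.apply_self (hK : Module.finrank F K = 2)
    (hσ : IsBaerInvolution σ) (hW : IsSymplecticSubgeometry h σ) (v : V) :
    h (σ v) v = 0 ∧ h v v + h (σ v) (σ v) = 0 := by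
  have key : ∀ c : K, c * conj F K c * (h v v + h (σ v) (σ v)) + c ^ 2 * h (σ v) v
      + conj F K c ^ 2 * h v (σ v) = 0 := by
    intro c
    have := hW (c • v + σ (c • v)) (by rw [map_add, hσ, add_comm])
    simp only [map_add, map_smulₛₗ, LinearMap.add_apply, LinearMap.smul_apply, smul_eq_mul,
      RingHom.id_apply, conj_conj hK] at this
    linear_combination this
  obtain ⟨θ, hθ⟩ := exists_conj_ne hK
  have hθ' : θ - conj F K θ ≠ 0 := sub_ne_zero.mpr hθ.symm
  have h1 := key 1
  have h2 := key θ
  have h3 := key (θ + 1)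
  simp only [map_add, map_one] at h1 h2 h3
  have e1 : θ * h (σ v) v = conj F K θ * h v (σ v) := by
    apply mul_left_cancel₀ hθ'
    linear_combination h2 - θ * conj F K θ * h1
  have e2 : (θ + 1) * h (σ v) v = (conj F K θ + 1) * h v (σ v) := by
    apply mul_left_cancel₀ hθ'
    linear_combination h3 - (θ + 1) * (conj F K θ + 1) * h1
  have e3 : h (σ v) v = h v (σ v) := by linear_combination e2 - e1
  have e4 : h (σ v) v = 0 := by
    apply mul_left_cancel₀ hθ'
    linear_combination e1 - conj F K θ * e3
  exact ⟨e4, by linear_combination h1 - e4 - e3.symm.trans e4⟩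

/-- The data of a Hermitian surface in `PG(3, q²)` with a symplectic Baer subgeometry. -/
structure IsSymplecticPair (h : V →ₛₗ[conj F K] V →ₗ[K] K) (σ : V →ₛₗ[conj F K] V) : Prop where
  finrank_base : Module.finrank F K = 2
  finrank_space : Module.finrank K V = 4
  hermitian : IsHermitianForm h
  involution : IsBaerInvolution σ
  symplectic : IsSymplecticSubgeometry h σ

namespace IsSymplecticPair

variable (H : IsSymplecticPair h σ)
include H

theorem apply_map_self (v : V) : h (σ v) v = 0 :=
  (H.symplectic.apply_self H.finrank_base H.involution v).1

theorem apply_self_map (v : V) : h v (σ v) = 0 := by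
  rw [H.hermitian.conj_symm, H.apply_map_self, map_zero]

theorem apply_eq_zero_symm {u v : V} (huv : h u v = 0) : h v u = 0 := by
  rw [H.hermitian.conj_symm, huv, map_zero]

theorem apply_map_map (u v : V) : h (σ u) (σ v) = -h v u := by
  let s : V →ₛₗ[conj F K] V →ₗ[K] K :=
    LinearMap.mk₂'ₛₗ (conj F K) (RingHom.id K) (fun u v => h u v + h (σ v) (σ u))
      (by intros; simp only [map_add, LinearMap.add_apply]; ring)
      (by intros; simp only [map_smulₛₗ, LinearMap.smul_apply, smul_eq_mul, RingHom.id_apply]; ring)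
      (by intros; simp only [map_add, LinearMap.add_apply]; ring)
      (by
        intros
        simp only [map_smulₛₗ, LinearMap.smul_apply, smul_eq_mul, RingHom.id_apply,
          conj_conj H.finrank_base]
        ring)
  have := sesquilinear_eq_zero H.finrank_base s
    (fun v => (H.symplectic.apply_self H.finrank_base H.involution v).2) v u
  exact eq_neg_of_add_eq_zero_right this

theorem finite : Finite V := by
  have : Module.Finite K V := Module.finite_of_finrank_pos (by rw [H.finrank_space]; omega)
  exact Module.finite_of_finite K

theorem map_injective : Function.Injective σ :=
  Function.LeftInverse.injective H.involution

theorem map_ne_zero {v : V} (hv : v ≠ 0) : σ v ≠ 0 :=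
  (map_ne_zero_iff σ H.map_injective).mpr hv

theorem finrank_conjugate (l : Submodule K V) (hl : Module.finrank K l = 2) :
    Module.finrank K (conjugate σ l) = 2 := by
  have := H.finite
  obtain ⟨v, hv, hv0⟩ := Submodule.exists_mem_ne_zero_of_ne_bot
    (p := l) (by rintro rfl; simp at hl)
  obtain ⟨w, hw, hli⟩ := exists_linearIndependent_pair_mem hl hv0
  have hli' : LinearIndependent K ![σ v, σ w] := by
    rw [LinearIndependent.pair_iff] at hli ⊢
    intro s t hst
    have := congrArg σ hst
    simp only [map_add, map_smulₛₗ, H.involution _, map_zero] at this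
    simpa using hli _ _ this
  rw [conjugate, ← span_pair_eq hl hv hw hli, Submodule.map_span, Set.image_pair,
    finrank_span_pair hli']

theorem conjugate_conjugate (l : Submodule K V) : conjugate σ (conjugate σ l) = l := by
  ext x
  simp only [conjugate, Submodule.mem_map]
  constructor
  · rintro ⟨_, ⟨y, hy, rfl⟩, rfl⟩
    rwa [H.involution]
  · intro hx
    exact ⟨σ x, ⟨x, hx, rfl⟩, H.involution x⟩

theorem mem_conjugate {l : Submodule K V} {v : V} : v ∈ conjugate σ l ↔ σ v ∈ l := by
  constructor
  · rintro ⟨x, hx, rfl⟩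
    rwa [H.involution]
  · intro hv
    exact ⟨σ v, hv, H.involution v⟩

theorem conjugate_mem_hermitianLines {l : Submodule K V} (hl : l ∈ hermitianLines h) :
    conjugate σ l ∈ hermitianLines h := by
  refine ⟨H.finrank_conjugate l hl.1, ?_⟩
  rintro _ ⟨u, hu, rfl⟩ _ ⟨v, hv, rfl⟩
  rw [H.apply_map_map, hl.2 v hv u hu, neg_zero]

/-- A line of the surface is equal to its polar. -/
theorem mem_of_forall_apply_eq_zero {l : Submodule K V} (hl : l ∈ hermitianLines h) {u : V}
    (hu : ∀ x ∈ l, h x u = 0) : u ∈ l := by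
  have := H.finite
  let B : LinearMap.BilinForm K V := LinearMap.mk₂ K (fun u v => h (σ u) v)
    (by intros; simp only [map_add, LinearMap.add_apply])
    (by
      intros
      simp only [map_smulₛₗ, LinearMap.smul_apply, smul_eq_mul, conj_conj H.finrank_base])
    (by intros; simp only [map_add])
    (by intros; simp only [map_smul])
  have hBalt : B.IsAlt := H.apply_map_self
  have hB : B.Nondegenerate := by
    refine LinearMap.BilinForm.Nondegenerate.ofSeparatingLeft ?_
    intro v hv
    have := H.hermitian.nondegenerate (σ v) hv
    exact (map_eq_zero_iff σ H.map_injective).mp this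
  have hle : l ≤ B.orthogonal (conjugate σ l) := by
    rintro v hv _ ⟨u, hu, rfl⟩
    change h (σ (σ u)) v = 0
    rw [H.involution]
    exact hl.2 u hu v hv
  have heq : l = B.orthogonal (conjugate σ l) := by
    refine Submodule.eq_of_le_of_finrank_eq hle ?_
    rw [LinearMap.BilinForm.finrank_orthogonal hB, H.finrank_conjugate l hl.1, H.finrank_space,
      hl.1]
  rw [heq]
  rintro _ ⟨x, hx, rfl⟩
  change h (σ (σ x)) u = 0
  rw [H.involution]
  exact hu x hx

end IsSymplecticPair
end Forms
end HermitianSurface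

namespace HermitianSurface

section ProjectiveLine

variable {K V : Type*} [Field K] [Finite K] [AddCommGroup V] [Module K V]

/-- Counting points of a projective line in an affine parametrisation. -/
theorem ncard_points_span_pair {v w : V} (hli : LinearIndependent K ![v, w])
    (p : Submodule K V → Prop) [Decidable (p (K ∙ v))] :
    {P : Projectivization K V | P.submodule ≤ Submodule.span K {v, w} ∧ p P.submodule}.ncard =
      {t : K | p (K ∙ (t • v + w))}.ncard + if p (K ∙ v) then 1 else 0 := by
  have hli' := LinearIndependent.pair_iff.mp hli
  have hv0 : v ≠ 0 := by
    rintro rfl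
    simpa using hli' 1 0 (by simp)
  have hw0 : ∀ t : K, t • v + w ≠ 0 := by
    intro t ht
    simpa using hli' t 1 (by simpa using ht)
  have hinj : ∀ t s : K, Projectivization.mk K (t • v + w) (hw0 t) =
      Projectivization.mk K (s • v + w) (hw0 s) → t = s := by
    intro t s hts
    obtain ⟨a, ha⟩ := (Projectivization.mk_eq_mk_iff' K _ _ _ _).mp hts
    have := hli' (a * s - t) (a - 1) (by
      have : a • (s • v + w) - (t • v + w) = 0 := by rw [ha, sub_self]
      rw [← this]; module)
    have ha1 : a = 1 := sub_eq_zero.mp this.2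
    rw [ha1, one_mul] at this
    exact (sub_eq_zero.mp this.1).symm
  have hne : ∀ t : K, Projectivization.mk K (t • v + w) (hw0 t) ≠ Projectivization.mk K v hv0 := by
    intro t ht
    obtain ⟨a, ha⟩ := (Projectivization.mk_eq_mk_iff' K _ _ _ _).mp ht
    have := hli' (a - t) (-1) (by
      have : a • v - (t • v + w) = 0 := by rw [ha, sub_self]
      rw [← this]; module)
    simpa using this.2
  let g : K → Projectivization K V := fun t => Projectivization.mk K (t • v + w) (hw0 t)
  have hset : {P : Projectivization K V | P.submodule ≤ Submodule.span K {v, w} ∧ p P.submodule} =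
      g '' {t : K | p (K ∙ (t • v + w))} ∪ {P | P = Projectivization.mk K v hv0 ∧ p (K ∙ v)} := by
    ext P
    constructor
    · rintro ⟨hP, hpP⟩
      induction P using Projectivization.ind with | h x hx => ?_
      rw [Projectivization.submodule_mk] at hP hpP
      obtain ⟨a, b, rfl⟩ := Submodule.mem_span_pair.mp (hP (Submodule.mem_span_singleton_self x))
      by_cases hb : b = 0
      · right
        have hmk : Projectivization.mk K (a • v + b • w) hx = Projectivization.mk K v hv0 :=
          (Projectivization.mk_eq_mk_iff' K _ _ _ _).mpr ⟨a, by simp [hb]⟩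
        refine ⟨hmk, ?_⟩
        rwa [← Projectivization.submodule_mk v hv0, ← hmk, Projectivization.submodule_mk]
      · left
        have hmk : g (b⁻¹ * a) = Projectivization.mk K (a • v + b • w) hx := by
          refine (Projectivization.mk_eq_mk_iff' K _ _ _ _).mpr ⟨b⁻¹, ?_⟩
          rw [smul_add, smul_smul, smul_smul, inv_mul_cancel₀ hb, one_smul]
        refine ⟨b⁻¹ * a, ?_, hmk⟩
        change p _
        rwa [← Projectivization.submodule_mk _ (hw0 _), show Projectivization.mk K _ (hw0 _) = _
          from hmk, Projectivization.submodule_mk]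
    · rintro (⟨t, ht, rfl⟩ | ⟨rfl, hp⟩)
      · refine ⟨?_, by simpa [g] using ht⟩
        simp only [g, Projectivization.submodule_mk, Submodule.span_singleton_le_iff_mem]
        exact Submodule.mem_span_pair.mpr ⟨t, 1, by simp⟩
      · refine ⟨?_, by simpa using hp⟩
        rw [Projectivization.submodule_mk, Submodule.span_singleton_le_iff_mem]
        exact Submodule.subset_span (by simp)
  have hginj : Function.Injective g := hinj
  have hfin : {P | P = Projectivization.mk K v hv0 ∧ p (K ∙ v)}.Finite :=
    (Set.finite_singleton (Projectivization.mk K v hv0)).subset (fun P hP => hP.1)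
  rw [hset, Set.ncard_union_eq ?_ (Set.toFinite _) hfin, Set.ncard_image_of_injective _ hginj]
  · split_ifs with hp
    · simp [hp]
    · simp [hp]
  · rw [Set.disjoint_left]
    rintro _ ⟨t, _, rfl⟩ ⟨h2, _⟩
    exact hne t h2

theorem ncard_points_le {l : Submodule K V} (hl : Module.finrank K l = 2) :
    {P : Projectivization K V | P.submodule ≤ l}.ncard = Nat.card K + 1 := by
  classical
  obtain ⟨v, hv, hv0⟩ := Submodule.exists_mem_ne_zero_of_ne_bot
    (p := l) (by rintro rfl; simp at hl)
  obtain ⟨w, hw, hli⟩ := exists_linearIndependent_pair_mem hl hv0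
  have := ncard_points_span_pair hli (fun _ => True)
  simpa [span_pair_eq hl hv hw hli, Set.ncard_univ] using this

end ProjectiveLine

section SkewForm

variable {F K V : Type*} [Field F] [Fintype F] [Field K] [Finite K] [Algebra F K]
  [AddCommGroup V] [Module K V]

/-- A nondegenerate skew-Hermitian form on a plane has `q + 1` isotropic points. -/
theorem ncard_isotropic_points (hK : Module.finrank F K = 2) (s : V →ₛₗ[conj F K] V →ₗ[K] K)
    {l : Submodule K V} (hl : Module.finrank K l = 2)
    (hskew : ∀ x ∈ l, ∀ y ∈ l, s x y = -conj F K (s y x))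
    (hnd : ∀ x ∈ l, (∀ y ∈ l, s x y = 0) → x = 0) :
    {P : Projectivization K V | P.submodule ≤ l ∧ ∀ x ∈ P.submodule, s x x = 0}.ncard =
      Fintype.card F + 1 := by
  classical
  have hsingle : ∀ x : V, (∀ y ∈ K ∙ x, s y y = 0) ↔ s x x = 0 := by
    intro x
    refine ⟨fun hx => hx x (Submodule.mem_span_singleton_self x), fun hx y hy => ?_⟩
    obtain ⟨c, rfl⟩ := Submodule.mem_span_singleton.mp hy
    simp [hx]
  obtain ⟨v, hv, hv0⟩ := Submodule.exists_mem_ne_zero_of_ne_bot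
    (p := l) (by rintro rfl; simp at hl)
  obtain ⟨w, hw, hli⟩ := exists_linearIndependent_pair_mem hl hv0
  have hspan := span_pair_eq hl hv hw hli
  have hcount := ncard_points_span_pair hli (fun S => ∀ x ∈ S, s x x = 0)
  rw [hspan] at hcount
  rw [hcount]
  simp only [hsingle]
  have hmem : ∀ y ∈ l, ∃ a b : K, a • v + b • w = y := by
    intro y hy
    rw [← hspan] at hy
    exact Submodule.mem_span_pair.mp hy
  have hwv : s w v = -conj F K (s v w) := hskew w hw v hv
  have hvv : conj F K (s v v) = -s v v := by linear_combination hskew v hv v hv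
  have hww : conj F K (s w w) = -s w w := by linear_combination hskew w hw w hw
  have hexp : ∀ t : K, s (t • v + w) (t • v + w) =
      t * conj F K t * s v v + conj F K t * s v w - t * conj F K (s v w) + s w w := by
    intro t
    simp only [map_add, map_smulₛₗ, LinearMap.add_apply, LinearMap.smul_apply, smul_eq_mul,
      RingHom.id_apply, hwv]
    ring
  simp only [hexp]
  by_cases ha : s v v = 0
  · have hb : s v w ≠ 0 := by
      intro hb
      refine hv0 (hnd v hv ?_)
      intro y hy
      obtain ⟨a, b, rfl⟩ := hmem y hy
      simp [ha, hb]
    rw [if_pos ha, ← ncard_sub_conj_eq hK (s w w) hww]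
    congr 1
    refine Set.ncard_congr (fun t _ => t * conj F K (s v w)) ?_ ?_ ?_
    · intro t (ht : _ = _)
      change _ - conj F K _ = _
      rw [map_mul, conj_conj hK]
      rw [ha] at ht
      linear_combination -ht
    · intro t r _ _ htr
      exact mul_right_cancel₀ ((_root_.map_ne_zero _).mpr hb) htr
    · intro r (hr : _ = _)
      have hb' := (_root_.map_ne_zero (conj F K)).mpr hb
      refine ⟨r / conj F K (s v w), ?_, div_mul_cancel₀ _ hb'⟩
      change _ = _
      rw [ha, map_div₀, conj_conj hK, div_mul_cancel₀ _ hb, div_mul_cancel₀ _ hb']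
      linear_combination -hr
  · set b := s v w with hbdef
    set a := s v v with hadef
    set d := s w w with hddef
    have hca : conj F K a ≠ 0 := (_root_.map_ne_zero _).mpr ha
    have hdet : a * d + b * conj F K b ≠ 0 := by
      intro h0
      have hx : -b • v + a • w = 0 := by
        refine hnd _ (l.add_mem (l.smul_mem _ hv) (l.smul_mem _ hw)) ?_
        intro y hy
        obtain ⟨e, f, rfl⟩ := hmem y hy
        simp only [map_add, map_smulₛₗ, LinearMap.add_apply, LinearMap.smul_apply, smul_eq_mul,
          RingHom.id_apply, hwv, ← hbdef, ← hadef, ← hddef, map_neg, hvv]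
        linear_combination -f * h0
      exact ha (LinearIndependent.pair_iff.mp hli _ _ hx).2
    rw [if_neg ha, add_zero, ← ncard_mul_conj_eq hK (-(a * d + b * conj F K b) / a ^ 2)
      (by simp only [map_div₀, map_neg, map_add, map_mul, map_pow, hvv, hww, conj_conj hK]; ring)
      (div_ne_zero (neg_ne_zero.mpr hdet) (pow_ne_zero 2 ha))]
    refine Set.ncard_congr (fun t _ => t + b / a) ?_ ?_ ?_
    · intro t (ht : _ = _)
      change _ * conj F K _ = _
      rw [map_add, map_div₀, hvv]
      field_simp
      linear_combination a * ht
    · intro t r _ _ htr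
      exact add_right_cancel htr
    · intro r (hr : _ = _)
      refine ⟨r - b / a, ?_, sub_add_cancel _ _⟩
      change _ = _
      rw [map_sub, map_div₀, hvv]
      field_simp at hr ⊢
      linear_combination hr

end SkewForm
end HermitianSurface

namespace HermitianSurface
namespace IsSymplecticPair

variable {F K V : Type*} [Field F] [Fintype F] [Field K] [Finite K] [Algebra F K]
  [AddCommGroup V] [Module K V] {h : V →ₛₗ[conj F K] V →ₗ[K] K} {σ : V →ₛₗ[conj F K] V}
  (H : IsSymplecticPair h σ)
include H

section Line

variable {l : Submodule K V} (hl : l ∈ hermitianLines h \ symplecticLines h σ)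
include hl

theorem eq_zero_of_mem_of_map_mem {v : V} (hv : v ∈ l) (hσv : σ v ∈ l) : v = 0 := by
  by_contra hv0
  obtain ⟨w, hw, hli⟩ := exists_linearIndependent_pair_mem hl.1.1 hv0
  have hspan := span_pair_eq hl.1.1 hv hw hli
  have hσw : σ w ∈ l := by
    refine H.mem_of_forall_apply_eq_zero hl.1 fun x hx => ?_
    rw [← hspan] at hx
    obtain ⟨a, b, rfl⟩ := Submodule.mem_span_pair.mp hx
    have h1 : h v (σ w) = 0 := by
      rw [← H.involution v, H.apply_map_map, hl.1.2 w hw _ hσv, neg_zero]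
    simp [h1, H.apply_self_map w]
  have hle : ∀ x ∈ l, σ x ∈ l := by
    intro x hx
    rw [← hspan] at hx
    obtain ⟨a, b, rfl⟩ := Submodule.mem_span_pair.mp hx
    simp only [map_add, map_smulₛₗ]
    exact l.add_mem (l.smul_mem _ hσv) (l.smul_mem _ hσw)
  refine hl.2 ⟨hl.1, ?_⟩
  ext x
  rw [H.mem_conjugate]
  exact ⟨fun hx => by simpa [H.involution x] using hle _ hx, hle x⟩

theorem eq_zero_of_mem_of_mem_conjugate {v : V} (hv : v ∈ l) (hσv : v ∈ conjugate σ l) : v = 0 :=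
  H.eq_zero_of_mem_of_map_mem hl hv (H.mem_conjugate.mp hσv)

theorem conjugate_mem_outer : conjugate σ l ∈ hermitianLines h \ symplecticLines h σ := by
  refine ⟨H.conjugate_mem_hermitianLines hl.1, fun hc => hl.2 ⟨hl.1, ?_⟩⟩
  have := hc.2
  rw [H.conjugate_conjugate] at this
  exact this.symm

theorem isCompl_conjugate : IsCompl l (conjugate σ l) := by
  have := H.finite
  have hdisj : Disjoint l (conjugate σ l) := by
    rw [Submodule.disjoint_def]
    exact fun x hx hx' => H.eq_zero_of_mem_of_mem_conjugate hl hx hx'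
  refine ⟨hdisj, codisjoint_iff.mpr ?_⟩
  apply Submodule.eq_top_of_finrank_eq
  have := Submodule.finrank_sup_add_finrank_inf_eq l (conjugate σ l)
  rw [hdisj.eq_bot, finrank_bot, add_zero, hl.1.1, H.finrank_conjugate l hl.1.1] at this
  rw [this, H.finrank_space]

theorem point_mem_outer {P : Projectivization K V} (hP : P.submodule ≤ l) :
    P ∈ hermitianPoints h \ symplecticPoints h σ := by
  refine ⟨fun v hv => hl.1.2 v (hP hv) v (hP hv), fun hc => P.rep_nonzero ?_⟩
  have hmem : P.rep ∈ P.submodule := by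
    rw [Projectivization.submodule_eq]; exact Submodule.mem_span_singleton_self _
  refine H.eq_zero_of_mem_of_map_mem hl (hP hmem) (hP ?_)
  have h2 := hc.2
  rw [← h2] at hmem
  exact H.mem_conjugate.mp hmem

theorem apply_map_ne_zero {v w : V} (hv : v ∈ l) (hw : w ∈ l)
    (hli : LinearIndependent K ![v, w]) : h v (σ w) ≠ 0 := by
  intro h0
  have hspan := span_pair_eq hl.1.1 hv hw hli
  have hw0 : w = 0 := by
    refine H.eq_zero_of_mem_of_map_mem hl hw (H.mem_of_forall_apply_eq_zero hl.1 fun x hx => ?_)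
    rw [← hspan] at hx
    obtain ⟨a, b, rfl⟩ := Submodule.mem_span_pair.mp hx
    simp [h0, H.apply_self_map w]
  have := (LinearIndependent.pair_iff.mp hli 0 1 (by simp [hw0])).2
  exact one_ne_zero this

/-- A vector of the conjugate line that is perpendicular to `v ∈ l` is a multiple of `σ v`. -/
theorem exists_eq_smul_map {v x : V} (hv : v ∈ l) (hv0 : v ≠ 0) (hx : x ∈ conjugate σ l)
    (hvx : h v x = 0) : ∃ c : K, x = c • σ v := by
  obtain ⟨w, hw, hli⟩ := exists_linearIndependent_pair_mem hl.1.1 hv0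
  have hspan := span_pair_eq hl.1.1 hv hw hli
  obtain ⟨y, hy, rfl⟩ := hx
  rw [SetLike.mem_coe, ← hspan] at hy
  obtain ⟨c, d, rfl⟩ := Submodule.mem_span_pair.mp hy
  simp only [map_add, map_smulₛₗ, smul_eq_mul, H.apply_self_map v, mul_zero, zero_add,
    RingHom.id_apply] at hvx
  have hd := (mul_eq_zero.mp hvx).resolve_right (H.apply_map_ne_zero hl hv hw hli)
  exact ⟨conj F K c, by simp [hd]⟩

/-- There are exactly `q` lines outside the subgeometry on every point of such a line. -/
theorem ncard_lines_through {P : Projectivization K V} (hP : P.submodule ≤ l) :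
    {l' | l' ∈ hermitianLines h \ symplecticLines h σ ∧ P.submodule ≤ l'}.ncard =
      Fintype.card F := by
  have hK := H.finrank_base
  induction P using Projectivization.ind with | h v hv0 => ?_
  simp only [Projectivization.submodule_mk, Submodule.span_singleton_le_iff_mem] at hP ⊢
  obtain ⟨w, hw, hli⟩ := exists_linearIndependent_pair_mem hl.1.1 hv0
  have hspan := span_pair_eq hl.1.1 hP hw hli
  have hli' := LinearIndependent.pair_iff.mp hli
  have hε := H.apply_map_ne_zero hl hw hP (LinearIndependent.pair_symm_iff.mp hli)
  set ε := h w (σ v) with hεdef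
  have hεc : h (σ v) w = conj F K ε := H.hermitian.conj_symm _ _
  have hσv : σ v ∈ conjugate σ l := ⟨v, hP, rfl⟩
  have hind : ∀ a b c : K, a • v + b • w = c • σ v → a = 0 ∧ b = 0 := by
    intro a b c habc
    refine hli' a b (H.eq_zero_of_mem_of_mem_conjugate hl
      (l.add_mem (l.smul_mem _ hP) (l.smul_mem _ hw)) ?_)
    rw [habc]
    exact Submodule.smul_mem _ _ hσv
  have hliu : ∀ t : K, LinearIndependent K ![v, w + t • σ v] := by
    intro t
    rw [LinearIndependent.pair_iff]
    intro a b hab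
    refine hind a b (-(b * t)) ?_
    rw [← sub_eq_zero, ← hab]
    module
  have huu : ∀ t : K, h (w + t • σ v) (w + t • σ v) = t * ε + conj F K (t * ε) := by
    intro t
    simp only [map_add, map_smulₛₗ, LinearMap.add_apply, LinearMap.smul_apply, smul_eq_mul,
      RingHom.id_apply, hεc, ← hεdef, hl.1.2 w hw w hw, H.apply_map_map, hl.1.2 v hP v hP, map_mul]
    ring
  have hnot : ∀ l' ∈ hermitianLines h \ symplecticLines h σ, v ∈ l' → σ v ∉ l' :=
    fun l' hl' hv' hσ' => hv0 (H.eq_zero_of_mem_of_map_mem hl' hv' hσ')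
  have hout : ∀ s : K, conj F K s = -s → Submodule.span K {v, w + (s / ε) • σ v} ∈
      hermitianLines h \ symplecticLines h σ := by
    intro s hs
    refine ⟨⟨finrank_span_pair (hliu _), ?_⟩, ?_⟩
    · have hvu : h v (w + (s / ε) • σ v) = 0 := by
        simp [hl.1.2 v hP w hw, H.apply_self_map v]
      have huv := H.apply_eq_zero_symm hvu
      have huu' := huu (s / ε)
      rw [div_mul_cancel₀ _ hε, hs, add_neg_cancel] at huu'
      generalize w + (s / ε) • σ v = u at hvu huv huu'
      intro x hx y hy
      obtain ⟨a, b, rfl⟩ := Submodule.mem_span_pair.mp hx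
      obtain ⟨c, d, rfl⟩ := Submodule.mem_span_pair.mp hy
      simp [hvu, huv, huu', hl.1.2 v hP v hP]
    · rintro ⟨-, hfix⟩
      have hmem : σ v ∈ Submodule.span K {v, w + (s / ε) • σ v} := by
        rw [← H.mem_conjugate, hfix]
        exact Submodule.subset_span (by simp)
      obtain ⟨a, b, hab⟩ := Submodule.mem_span_pair.mp hmem
      obtain ⟨rfl, rfl⟩ := hind a b (1 - b * (s / ε)) (by
        rw [← sub_eq_zero] at hab ⊢; rw [← hab]; module)
      exact H.map_ne_zero hv0 (by simpa using hab.symm)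
  rw [← ncard_conj_eq_neg hK]
  symm
  refine Set.ncard_congr (fun s _ => Submodule.span K {v, w + (s / ε) • σ v}) ?_ ?_ ?_
  · intro s hs
    exact ⟨hout s hs, Submodule.subset_span (by simp)⟩
  · intro s r hs _ hsr
    by_contra hne
    refine hnot _ (hout s hs) (Submodule.subset_span (by simp)) ?_
    have h1 : w + (s / ε) • σ v ∈ Submodule.span K {v, w + (s / ε) • σ v} :=
      Submodule.subset_span (by simp)
    have h2 : w + (r / ε) • σ v ∈ Submodule.span K {v, w + (s / ε) • σ v} := by
      have hsr' : Submodule.span K {v, w + (s / ε) • σ v} =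
        Submodule.span K {v, w + (r / ε) • σ v} := hsr
      rw [hsr']
      exact Submodule.subset_span (by simp)
    have h3 := Submodule.sub_mem _ h1 h2
    have h4 : w + (s / ε) • σ v - (w + (r / ε) • σ v) = ((s - r) / ε) • σ v := by
      rw [sub_div]; module
    rw [h4] at h3
    exact (Submodule.smul_mem_iff _ (div_ne_zero (sub_ne_zero.mpr hne) hε)).mp h3
  · rintro l' ⟨hl', hvl'⟩
    obtain ⟨x, hx, hlix⟩ := exists_linearIndependent_pair_mem hl'.1.1 hv0
    obtain ⟨y, hy, z, hz, rfl⟩ := Submodule.mem_sup.mp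
      ((H.isCompl_conjugate hl).sup_eq_top ▸ Submodule.mem_top (x := x))
    have hvz : h v z = 0 := by
      have := hl'.1.2 v hvl' _ hx
      rwa [map_add, hl.1.2 v hP y hy, zero_add] at this
    obtain ⟨c, rfl⟩ := H.exists_eq_smul_map hl hP hv0 hz hvz
    rw [← hspan] at hy
    obtain ⟨a, b, rfl⟩ := Submodule.mem_span_pair.mp hy
    have hb : b ≠ 0 := by
      rintro rfl
      have hc : c ≠ 0 := by
        rintro rfl
        have := (LinearIndependent.pair_iff.mp hlix a (-1) (by module)).2
        simp at this
      refine hnot l' hl' hvl' ((Submodule.smul_mem_iff _ hc).mp ?_)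
      have := l'.sub_mem hx (l'.smul_mem a hvl')
      convert this using 1
      module
    have hu : w + (c / b) • σ v ∈ l' := by
      refine (Submodule.smul_mem_iff _ hb).mp ?_
      have := l'.sub_mem hx (l'.smul_mem a hvl')
      convert this using 1
      rw [smul_add, smul_smul, mul_div_cancel₀ _ hb]
      module
    refine ⟨c / b * ε, ?_, ?_⟩
    · have := huu (c / b)
      rw [hl'.1.2 _ hu _ hu] at this
      exact eq_neg_of_add_eq_zero_right this.symm
    · rw [mul_div_cancel_right₀ _ hε]
      exact span_pair_eq hl'.1.1 hvl' hu (hliu _)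

end Line

end IsSymplecticPair
end HermitianSurface

namespace HermitianSurface

theorem ncard_points_eq_one {K V : Type*} [Field K] [AddCommGroup V] [Module K V] {v : V}
    (hv0 : v ≠ 0) (p : Submodule K V → Prop) (hp : p (K ∙ v))
    (hle : ∀ x, p (K ∙ x) → x ∈ K ∙ v) :
    {P : Projectivization K V | p P.submodule}.ncard = 1 := by
  rw [Set.ncard_eq_one]
  refine ⟨Projectivization.mk K v hv0, Set.eq_singleton_iff_unique_mem.mpr ⟨by simpa using hp, ?_⟩⟩
  intro P hP
  induction P using Projectivization.ind with | h x hx => ?_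
  rw [Projectivization.mk_eq_mk_iff']
  refine Submodule.mem_span_singleton.mp (hle x ?_)
  simpa using hP

theorem ncard_points_eq_zero {K V : Type*} [Field K] [AddCommGroup V] [Module K V]
    (p : Submodule K V → Prop) (hp : ∀ x, p (K ∙ x) → x = 0) :
    {P : Projectivization K V | p P.submodule}.ncard = 0 := by
  convert Set.ncard_empty (Projectivization K V)
  rw [Set.eq_empty_iff_forall_notMem]
  intro P hP
  induction P using Projectivization.ind with | h x hx => ?_
  exact hx (hp x (by simpa using hP))

namespace IsSymplecticPair

variable {F K V : Type*} [Field F] [Fintype F] [Field K] [Finite K] [Algebra F K]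
  [AddCommGroup V] [Module K V] {h : V →ₛₗ[conj F K] V →ₗ[K] K} {σ : V →ₛₗ[conj F K] V}
  (H : IsSymplecticPair h σ)
include H

section Projection

variable {l l' : Submodule K V} (hl : l ∈ hermitianLines h \ symplecticLines h σ)
  (hl' : l' ∈ hermitianLines h \ symplecticLines h σ) {π : V →ₗ[K] V} (hπ : ∀ x, π x ∈ l)
  (hπ' : ∀ x, x - π x ∈ conjugate σ l)
include hl hl'

theorem eq_zero_of_mem_inf_conjugate {v x : V} (hv0 : v ≠ 0) (hv : v ∈ l) (hv' : v ∈ l')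
    (hx : x ∈ l') (hxl : x ∈ conjugate σ l) : x = 0 := by
  obtain ⟨c, rfl⟩ := H.exists_eq_smul_map hl hv hv0 hxl (hl'.1.2 v hv' x hx)
  by_contra hne
  have hc : c ≠ 0 := by rintro rfl; simp at hne
  exact hv0 (H.eq_zero_of_mem_of_map_mem hl' hv' ((Submodule.smul_mem_iff _ hc).mp hx))

omit H in
theorem mem_span_of_mem_inf {v x : V} (hne : l' ≠ l) (hv0 : v ≠ 0) (hv : v ∈ l) (hv' : v ∈ l')
    (hx : x ∈ l) (hx' : x ∈ l') : x ∈ K ∙ v := by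
  by_contra hspan
  have hli : LinearIndependent K ![v, x] := by
    rw [LinearIndependent.pair_iff' hv0]
    rintro a rfl
    exact hspan (Submodule.smul_mem _ _ (Submodule.mem_span_singleton_self v))
  exact hne ((span_pair_eq hl'.1.1 hv' hx' hli).symm.trans (span_pair_eq hl.1.1 hv hx hli))

include hπ hπ'

theorem ncard_isotropic_of_mem_inf {v : V} (hne : l' ≠ l) (hv0 : v ≠ 0) (hv : v ∈ l)
    (hv' : v ∈ l') :
    {P : Projectivization K V | P.submodule ≤ l' ∧ ∀ x ∈ P.submodule, h (π x) x = 0}.ncard = 1 := by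
  refine ncard_points_eq_one hv0 (fun S => S ≤ l' ∧ ∀ x ∈ S, h (π x) x = 0) ?_ ?_
  · have hle : K ∙ v ≤ l' ⊓ l := by
      rw [Submodule.span_singleton_le_iff_mem]; exact ⟨hv', hv⟩
    exact ⟨hle.trans inf_le_left, fun x hx => hl.1.2 _ (hπ x) _ (hle hx).2⟩
  · rintro x ⟨hx, hxx⟩
    rw [Submodule.span_singleton_le_iff_mem] at hx
    by_contra hspan
    have hli : LinearIndependent K ![v, x] := by
      rw [LinearIndependent.pair_iff' hv0]
      rintro a rfl
      exact hspan (Submodule.smul_mem _ _ (Submodule.mem_span_singleton_self v))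
    have hπx : π x ∈ l' := by
      refine H.mem_of_forall_apply_eq_zero hl'.1 fun y hy => H.apply_eq_zero_symm ?_
      rw [← span_pair_eq hl'.1.1 hv' hx hli] at hy
      obtain ⟨a, b, rfl⟩ := Submodule.mem_span_pair.mp hy
      simp [hl.1.2 _ (hπ x) v hv, hxx x (Submodule.mem_span_singleton_self x)]
    have h0 := H.eq_zero_of_mem_inf_conjugate hl hl' hv0 hv hv' (l'.sub_mem hx hπx) (hπ' x)
    rw [sub_eq_zero] at h0
    exact hspan (mem_span_of_mem_inf hl hl' hne hv0 hv hv' (h0 ▸ hπ x) hx)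

theorem ncard_isotropic_of_inf_eq_bot (h1 : ∀ x ∈ l', x ∈ l → x = 0)
    (h2 : ∀ x ∈ l', x ∈ conjugate σ l → x = 0) :
    {P : Projectivization K V | P.submodule ≤ l' ∧ ∀ x ∈ P.submodule, h (π x) x = 0}.ncard =
      Fintype.card F + 1 := by
  refine ncard_isotropic_points H.finrank_base (h.comp π) hl'.1.1 ?_ ?_
  · intro x hx y hy
    change h (π x) y = -conj F K (h (π y) x)
    have hc := (H.conjugate_mem_outer hl).1.2
    rw [← H.hermitian.conj_symm]
    have e1 : h x (π y) = h (x - π x) (π y) := by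
      rw [map_sub, LinearMap.sub_apply, hl.1.2 _ (hπ x) _ (hπ y), sub_zero]
    have e2 : h (π x) y = h x y - h (x - π x) (π y) - h (x - π x) (y - π y) := by
      simp only [map_sub, LinearMap.sub_apply]; ring
    rw [e2, e1, hl'.1.2 x hx y hy, hc _ (hπ' x) _ (hπ' y)]
    ring
  · intro x hx hxy
    have hπx : π x ∈ l' :=
      H.mem_of_forall_apply_eq_zero hl'.1 fun y hy => H.apply_eq_zero_symm (hxy y hy)
    have h0 := hπ' x
    rw [h1 _ hπx (hπ x), sub_zero] at h0
    exact h2 x hx h0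

open Classical in
/-- The number of points of `l'` isotropic for `x ↦ h (π x) x`, in terms of the number of points
common to `l'` and the lines `l` and `l ^ σ`. -/
theorem ncard_isotropic :
    ({P : Projectivization K V |
        P.submodule ≤ l' ∧ ∀ x ∈ P.submodule, h (π x) x = 0}.ncard : ℤ) =
      Fintype.card F + 1 - Fintype.card F *
        ({P : Projectivization K V | P.submodule ≤ l' ∧ P.submodule ≤ l}.ncard +
          {P : Projectivization K V | P.submodule ≤ l' ∧ P.submodule ≤ conjugate σ l}.ncard) +
      (Fintype.card F ^ 3 + Fintype.card F ^ 2) *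
        ((if l' = l then 1 else 0) + if l' = conjugate σ l then 1 else 0) := by
  have hc := H.conjugate_mem_outer hl
  have hlc : l ≠ conjugate σ l := fun heq => hl.2 ⟨hl.1, heq.symm⟩
  have hsq : ({P : Projectivization K V | P.submodule ≤ l'}.ncard : ℤ) =
      Fintype.card F ^ 2 + 1 := by
    rw [ncard_points_le hl'.1.1, card_eq_sq H.finrank_base]; push_cast; rfl
  have hdisj : ∀ S : Submodule K V, S ≤ l ∧ S ≤ conjugate σ l → S = ⊥ := fun S hS =>
    le_bot_iff.mp ((H.isCompl_conjugate hl).disjoint hS.1 hS.2)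
  by_cases h1 : l' = l
  · subst h1
    have hiso : ∀ S ≤ l', ∀ x ∈ S, h (π x) x = 0 := fun S hS x hx =>
      hl.1.2 _ (hπ x) _ (hS hx)
    have e1 : {P : Projectivization K V |
        P.submodule ≤ l' ∧ ∀ x ∈ P.submodule, h (π x) x = 0} = {P | P.submodule ≤ l'} := by
      ext P; exact ⟨fun hP => hP.1, fun hP => ⟨hP, hiso _ hP⟩⟩
    rw [e1, ncard_points_eq_zero (fun S => S ≤ l' ∧ S ≤ conjugate σ l')
      (fun x hx => by simpa using hdisj _ hx), if_pos rfl, if_neg hlc]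
    simp only [and_self, hsq]
    push_cast
    ring
  by_cases h2 : l' = conjugate σ l
  · have hiso : ∀ S ≤ l', ∀ x ∈ S, h (π x) x = 0 := fun S hS x hx => by
      have hx' : x ∈ conjugate σ l := h2 ▸ hS hx
      have : π x ∈ conjugate σ l := by
        have := (conjugate σ l).sub_mem hx' (hπ' x)
        rwa [sub_sub_cancel] at this
      rw [H.eq_zero_of_mem_of_mem_conjugate hl (hπ x) this, map_zero, LinearMap.zero_apply]
    have e1 : {P : Projectivization K V |
        P.submodule ≤ l' ∧ ∀ x ∈ P.submodule, h (π x) x = 0} = {P | P.submodule ≤ l'} := by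
      ext P; exact ⟨fun hP => hP.1, fun hP => ⟨hP, hiso _ hP⟩⟩
    rw [e1, ncard_points_eq_zero (fun S => S ≤ l' ∧ S ≤ l)
      (fun x hx => by rw [h2] at hx; simpa using hdisj _ hx.symm), if_neg h1, if_pos h2, ← h2]
    simp only [and_self, hsq]
    push_cast
    ring
  rw [if_neg h1, if_neg h2]
  have hone : ∀ {m : Submodule K V} {v : V}, m ∈ hermitianLines h \ symplecticLines h σ →
      l' ≠ m → v ≠ 0 → v ∈ m → v ∈ l' →
      {P : Projectivization K V | P.submodule ≤ l' ∧ P.submodule ≤ m}.ncard = 1 := by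
    intro m v hm hne hv0 hv hv'
    refine ncard_points_eq_one hv0 (fun S => S ≤ l' ∧ S ≤ m) (by simp [hv, hv']) fun x hx => ?_
    simp only [Submodule.span_singleton_le_iff_mem] at hx
    exact mem_span_of_mem_inf hm hl' hne hv0 hv hv' hx.2 hx.1
  have hzero : ∀ {m : Submodule K V}, (∀ x ∈ l', x ∈ m → x = 0) →
      {P : Projectivization K V | P.submodule ≤ l' ∧ P.submodule ≤ m}.ncard = 0 := by
    intro m hm
    refine ncard_points_eq_zero (fun S => S ≤ l' ∧ S ≤ m) fun x hx => ?_
    simp only [Submodule.span_singleton_le_iff_mem] at hx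
    exact hm x hx.1 hx.2
  by_cases h3 : ∃ v ∈ l', v ∈ l ∧ v ≠ 0
  · obtain ⟨v, hv', hv, hv0⟩ := h3
    rw [H.ncard_isotropic_of_mem_inf hl hl' hπ hπ' h1 hv0 hv hv', hone hl h1 hv0 hv hv',
      hzero fun x hx hx' => H.eq_zero_of_mem_inf_conjugate hl hl' hv0 hv hv' hx hx']
    push_cast
    ring
  by_cases h4 : ∃ v ∈ l', v ∈ conjugate σ l ∧ v ≠ 0
  · obtain ⟨v, hv', hv, hv0⟩ := h4
    have hswap : {P : Projectivization K V | P.submodule ≤ l' ∧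
        ∀ x ∈ P.submodule, h (π x) x = 0} = {P : Projectivization K V | P.submodule ≤ l' ∧
        ∀ x ∈ P.submodule, h ((LinearMap.id - π : V →ₗ[K] V) x) x = 0} := by
      ext P
      refine and_congr_right fun hP => forall₂_congr fun x hx => ?_
      have := hl'.1.2 x (hP hx) x (hP hx)
      simp [this]
    rw [hswap, H.ncard_isotropic_of_mem_inf hc hl' (π := LinearMap.id - π) hπ' ?_ h2 hv0 hv hv',
      hone hc h2 hv0 hv hv', hzero fun x hx hx' => ?_]
    · push_cast
      ring
    · refine H.eq_zero_of_mem_inf_conjugate hc hl' hv0 hv hv' hx ?_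
      rwa [H.conjugate_conjugate]
    · intro x
      rw [H.conjugate_conjugate]
      simpa using hπ x
  push Not at h3 h4
  rw [H.ncard_isotropic_of_inf_eq_bot hl hl' hπ hπ' h3 h4, hzero h3, hzero h4]
  push_cast
  ring

end Projection
end IsSymplecticPair
end HermitianSurface

namespace HermitianSurface
namespace IsSymplecticPair

variable {F K V : Type*} [Field F] [Fintype F] [Field K] [Finite K] [Algebra F K]
  [AddCommGroup V] [Module K V] {h : V →ₛₗ[conj F K] V →ₗ[K] K} {σ : V →ₛₗ[conj F K] V}
  (H : IsSymplecticPair h σ)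
include H

open Classical in
/-- On a point of a line outside the subgeometry, the function `q χ_Y - m` sums to zero. -/
theorem sum_lines_through_eq_zero {m : ℕ} {Y : Set (Submodule K V)} (hY : IsCover h σ m Y)
    (X : Finset (Submodule K V)) (hX : (X : Set (Submodule K V)) =
      hermitianLines h \ symplecticLines h σ) {l : Submodule K V} (hl : l ∈ X)
    {P : Projectivization K V} (hP : P.submodule ≤ l) :
    ∑ l' ∈ X with P.submodule ≤ l',
      ((Fintype.card F : ℤ) * (if l' ∈ Y then 1 else 0) - m) = 0 := by
  have hl' : l ∈ hermitianLines h \ symplecticLines h σ := hX ▸ hl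
  have hYX : ∀ l' ∈ Y, l' ∈ X := fun l' h' => by
    rw [← Finset.mem_coe, hX]; exact hY.subset h'
  have h1 : ((X.filter (P.submodule ≤ ·)).filter (· ∈ Y)).card = m := by
    rw [← hY.ncard_eq P (H.point_mem_outer hl' hP), ← Set.ncard_coe_finset]
    congr 1
    ext l'
    simp only [Finset.coe_filter, Finset.mem_filter, Set.mem_ofPred_eq]
    exact ⟨fun hh => ⟨hh.2, hh.1.2⟩, fun hh => ⟨⟨hYX _ hh.1, hh.2⟩, hh.1⟩⟩
  have h2 : (X.filter (P.submodule ≤ ·)).card = Fintype.card F := by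
    rw [← H.ncard_lines_through hl' hP, ← Set.ncard_coe_finset, ← hX]
    congr 1
    ext l'
    simp
  rw [Finset.sum_sub_distrib, ← Finset.mul_sum, Finset.sum_boole, h1, Finset.sum_const, h2]
  simp

open Classical in
theorem sum_mul_ncard_points_eq_zero {m : ℕ} {Y : Set (Submodule K V)} (hY : IsCover h σ m Y)
    (X : Finset (Submodule K V)) (hX : (X : Set (Submodule K V)) =
      hermitianLines h \ symplecticLines h σ) (p : Submodule K V → Prop) :
    ∑ l' ∈ X, ((Fintype.card F : ℤ) * (if l' ∈ Y then 1 else 0) - m) *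
      ({P : Projectivization K V | P.submodule ≤ l' ∧ p P.submodule}.ncard : ℤ) = 0 := by
  have := H.finite
  have := Fintype.ofFinite (Projectivization K V)
  have hcard : ∀ l' : Submodule K V,
      ({P : Projectivization K V | P.submodule ≤ l' ∧ p P.submodule}.ncard : ℤ) =
        ∑ P : Projectivization K V with p P.submodule, if P.submodule ≤ l' then 1 else 0 := by
    intro l'
    rw [Finset.sum_boole, Finset.filter_filter, ← Set.ncard_coe_finset]
    congr 2
    ext P
    simp [and_comm]
  simp only [hcard, Finset.mul_sum]
  rw [Finset.sum_comm]
  refine Finset.sum_eq_zero fun P _ => ?_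
  simp only [mul_ite, mul_one, mul_zero]
  rw [← Finset.sum_filter]
  rcases (X.filter (P.submodule ≤ ·)).eq_empty_or_nonempty with he | ⟨l, hl⟩
  · rw [he, Finset.sum_empty]
  · rw [Finset.mem_filter] at hl
    simpa using H.sum_lines_through_eq_zero hY X hX hl.1 hl.2

open Classical in
/-- Every cover meets all the pairs of conjugate lines equally. -/
theorem card_mul_indicator_add {m : ℕ} {Y : Set (Submodule K V)} (hY : IsCover h σ m Y)
    {l : Submodule K V} (hl : l ∈ hermitianLines h \ symplecticLines h σ) :
    Fintype.card F * ((if l ∈ Y then 1 else 0) + if conjugate σ l ∈ Y then 1 else 0) = 2 * m := by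
  have := H.finite
  obtain ⟨X, hX⟩ := (Set.toFinite (hermitianLines h \ symplecticLines h σ)).exists_finset_coe
  have hmem : ∀ l', l' ∈ X ↔ l' ∈ hermitianLines h \ symplecticLines h σ := fun l' => by
    rw [← hX, Finset.mem_coe]
  have hsum := H.sum_mul_ncard_points_eq_zero hY X hX
  set f : Submodule K V → ℤ := fun l' => (Fintype.card F : ℤ) * (if l' ∈ Y then 1 else 0) - m
    with hf
  change ∀ p, ∑ l' ∈ X, f l' * _ = 0 at hsum
  have htotal : ∑ l' ∈ X, f l' = 0 := by
    have := hsum fun _ => True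
    rw [Finset.sum_congr rfl (g := fun l' => f l' * ((Nat.card K + 1 : ℕ) : ℤ)) fun l' hl' => by
      simp only [and_true]; rw [ncard_points_le ((hmem l').mp hl').1.1], ← Finset.sum_mul] at this
    exact (mul_eq_zero.mp this).resolve_right (by positivity)
  have hcompl := H.isCompl_conjugate hl
  have key := hsum fun S => ∀ x ∈ S, h (l.projection (conjugate σ l) hcompl x) x = 0
  have hlsum := hsum fun S => S ≤ l
  have hcsum := hsum fun S => S ≤ conjugate σ l
  rw [Finset.sum_congr rfl fun l' hl' => by
    rw [H.ncard_isotropic hl ((hmem l').mp hl') (Submodule.projection_apply_mem hcompl)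
      (Submodule.sub_projection_mem hcompl)]] at key
  have hsplit : ∀ l' : Submodule K V, ∀ i j : ℤ, f l' * (Fintype.card F + 1 - Fintype.card F *
      (i + j) + (Fintype.card F ^ 3 + Fintype.card F ^ 2) *
        ((if l' = l then 1 else 0) + if l' = conjugate σ l then 1 else 0)) =
      (Fintype.card F + 1) * f l' - Fintype.card F * (f l' * i) - Fintype.card F * (f l' * j) +
        (Fintype.card F ^ 3 + Fintype.card F ^ 2) * ((if l' = l then f l' else 0) +
          if l' = conjugate σ l then f l' else 0) := by
    intro l' i j
    split_ifs <;> ring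
  simp only [hsplit] at key
  rw [Finset.sum_add_distrib, Finset.sum_sub_distrib, Finset.sum_sub_distrib, ← Finset.mul_sum,
    ← Finset.mul_sum, ← Finset.mul_sum, ← Finset.mul_sum, htotal, hlsum, hcsum,
    Finset.sum_add_distrib, Finset.sum_ite_eq' X l, Finset.sum_ite_eq' X (conjugate σ l),
    if_pos ((hmem _).mpr hl), if_pos ((hmem _).mpr (H.conjugate_mem_outer hl))] at key
  have hq : 0 < Fintype.card F := Fintype.card_pos
  have h0 : f l + f (conjugate σ l) = 0 := by
    have hpos : ((Fintype.card F : ℤ) ^ 3 + Fintype.card F ^ 2) ≠ 0 := by positivity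
    refine (mul_eq_zero.mp ?_).resolve_left hpos
    linear_combination key
  zify
  simp only [hf] at h0
  linear_combination h0

end IsSymplecticPair
end HermitianSurface

theorem mainTheorem7 {F K V : Type*} [Field F] [Fintype F] [Field K] [Finite K] [Algebra F K]
    [AddCommGroup V] [Module K V]
    (q : ℕ) (hq : Fintype.card F = q) (hK : Module.finrank F K = 2) (hV : Module.finrank K V = 4)
    (h : V →ₛₗ[HermitianSurface.conj F K] V →ₗ[K] K) (hh : HermitianSurface.IsHermitianForm h)
    (σ : V →ₛₗ[HermitianSurface.conj F K] V) (hσ : HermitianSurface.IsBaerInvolution σ)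
    (hW : HermitianSurface.IsSymplecticSubgeometry h σ)
    (m : ℕ) (Y : Set (Submodule K V)) (hY : HermitianSurface.IsNontrivialCover h σ m Y) :
    Even q ∧ m = q / 2 ∧
      ∀ l ∈ HermitianSurface.hermitianLines h \ HermitianSurface.symplecticLines h σ,
        Xor (l ∈ Y) (HermitianSurface.conjugate σ l ∈ Y) := by
  classical
  subst hq
  have H : HermitianSurface.IsSymplecticPair h σ := ⟨hK, hV, hh, hσ, hW⟩
  have key := fun l hl => H.card_mul_indicator_add hY.toIsCover (l := l) hl
  have hq : 0 < Fintype.card F := Fintype.card_pos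
  obtain ⟨a, haY⟩ := hY.nonempty
  have ha := hY.subset haY
  obtain ⟨b, hb, hbY⟩ : ∃ b ∈ HermitianSurface.hermitianLines h \
      HermitianSurface.symplecticLines h σ, b ∉ Y := by
    by_contra! hall
    exact hY.ne_all (hY.subset.antisymm hall)
  have hka := key a ha
  have hkb := key b hb
  rw [if_pos haY] at hka
  rw [if_neg hbY] at hkb
  have hqm : Fintype.card F = 2 * m := by
    split_ifs at hka hkb <;> omega
  refine ⟨⟨m, by omega⟩, by omega, fun l hl => ?_⟩
  have hkl := key l hl
  by_cases h1 : l ∈ Y <;> by_cases h2 : HermitianSurface.conjugate σ l ∈ Y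
  · rw [if_pos h1, if_pos h2] at hkl; omega
  · exact Or.inl ⟨h1, h2⟩
  · exact Or.inr ⟨h2, h1⟩
  · rw [if_neg h1, if_neg h2] at hkl; omega
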